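/- Let $(M,\theta)$ be a strictly pseudoconvex CR manifold of real dimension $2n+1$: a smooth manifold with a smooth nowhere vanishing $1$-form $\theta$ and an integrable complex structure $J$ on $H(M)=\ker\theta$ such that the Levi form $G_\theta(X,Y)=-d\theta(JX,Y)$ is positive definite on $H(M)$. Let $\nabla$ be its Tanaka–Webster connection, and let $\Delta_b u=\mathrm{trace}_{G_\theta}\nabla du$ be its sub-Laplacian. Let $\mathbb H^m=\mathbb C^m\times\mathbb R$ be the Heisenberg group, with coordinates $z_j=x_j+iy_j$ and $t$, vector fields $$X_j=\frac{\partial}{\partial x_j}+2y_j\frac{\partial}{\partial t},\qquad Y_j=\frac{\partial}{\partial y_j}-2x_j\frac{\partial}{\partial t}\qquad(1\le j\le m),$$ horizontal distribution $H(\mathbb H^m)$ spanned by the $X_j,Y_j$, complex structure with $JX_j=Y_j$, and pseudo-Hermitian structure $\theta_{\mathbb H^m}=dt+2\sum_j(x_j\,dy_j-y_j\,dx_j)$. Let $|\cdot|_{\mathbb H^m}$ be the norm of its Webster metric $g_{\mathbb H^m}$, that is, the Riemannian metric which equals the Levi form on $H(\mathbb H^m)$ and for which $\partial/\partial t$ is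 a unit vector orthogonal to $H(\mathbb H^m)$. Let $f=(F_1,\dots,F_m,\alpha):M\to\mathbb H^m\cong\mathbb C^m\times\mathbb R$ be a $C^2$ map such that $df(H(M))\subset H(\mathbb H^m)$, and put $\varphi_j=\mathrm{Re}\,F_j$, $\psi_j=\mathrm{Im}\,F_j$. Let $$H_b(f)=\mathrm{trace}_{G_\theta}\beta_f,\qquad \beta_f(X,Y)=\nabla^f_X\,df(Y)-df(\nabla_XY)\quad\text{on }H(M),$$ be the Levi tension of $f$, where $\nabla^f$ is the connection on $f^{-1}T\mathbb H^m$ induced by the Levi-Civita connection of $g_{\mathbb H^m}$. Then $$H_b(f)=\sum_{j=1}^m\bigl(\Delta_b\varphi_j\,X_j+\Delta_b\psi_j\,Y_j\bigr),$$ where $X_j$ and $Y_j$ are taken along $f$. In particular, $H_b(f)$ is horizontal, i.e. $H_b(f)(x)\in H_{f(x)}(\mathbb H^m)$ for every $x\in M$, and $$|H_b(f)|^2_{\mathbb H^m}=4\sum_{j=1}^m\bigl[(\Delta_b\varphi_j)^2+(\Delta_b\psi_j)^2\bigr].$$ -/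

import Mathlib

open Bundle
open scoped Manifold ContDiff Topology

namespace CRGeometry

section OneForms

variable {E : Type*} [NormedAddCommGroup E] [NormedSpace ℝ E]
  {M : Type*} [TopologicalSpace M] [ChartedSpace E M]

/-- `X(θ(Y)) - Y(θ(X)) - θ([X, Y])` for a one-form `θ` and vector fields `X`, `Y`. -/
noncomputable def extDerivFields (θ : Π x : M, TangentSpace 𝓘(ℝ, E) x →L[ℝ] ℝ)
    (X Y : Π x : M, TangentSpace 𝓘(ℝ, E) x) (x : M) : ℝ :=
  mvfderiv 𝓘(ℝ, E) (fun y ↦ θ y (Y y)) x (X x) - mvfderiv 𝓘(ℝ, E) (fun y ↦ θ y (X y)) x (Y x)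
    - θ x (VectorField.mlieBracket 𝓘(ℝ, E) X Y x)

theorem extDerivFields_swap (θ : Π x : M, TangentSpace 𝓘(ℝ, E) x →L[ℝ] ℝ)
    (X Y : Π x : M, TangentSpace 𝓘(ℝ, E) x) (x : M) :
    extDerivFields θ X Y x = - extDerivFields θ Y X x := by
  simp only [extDerivFields, VectorField.mlieBracket_swap_apply (V := X) (W := Y), map_neg]
  ring

/-- A one-form that is smooth (as a section of the cotangent bundle). -/
def IsSmoothForm [IsManifold 𝓘(ℝ, E) ∞ M] (θ : Π x : M, TangentSpace 𝓘(ℝ, E) x →L[ℝ] ℝ) : Prop :=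
  ContMDiff 𝓘(ℝ, E) (𝓘(ℝ, E).prod 𝓘(ℝ, E →L[ℝ] ℝ)) ∞
    (fun x ↦ TotalSpace.mk' (E →L[ℝ] ℝ) (E := fun x : M ↦ TangentSpace 𝓘(ℝ, E) x →L[ℝ] Trivial M ℝ x) x (θ x))

variable [IsManifold 𝓘(ℝ, E) ∞ M]

theorem IsSmoothForm.apply_mdiff {θ : Π x : M, TangentSpace 𝓘(ℝ, E) x →L[ℝ] ℝ} (h : IsSmoothForm θ)
   {X : Π x : M, TangentSpace 𝓘(ℝ, E) x} {x : M} (hX : MDiffAt (T% X) x) :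
   MDifferentiableAt 𝓘(ℝ, E) 𝓘(ℝ, ℝ) (fun y ↦ θ y (X y)) x := by
  have h1 := MDifferentiableAt.clm_bundle_apply ((h x).mdifferentiableAt (by simp)) hX
  exact (mdifferentiableAt_totalSpace _ _).1 h1 |>.2
theorem IsSmoothForm.apply_smooth {θ : Π x : M, TangentSpace 𝓘(ℝ, E) x →L[ℝ] ℝ} (h : IsSmoothForm θ)
   {X : Π x : M, TangentSpace 𝓘(ℝ, E) x} {x : M} (hX : CMDiffAt ∞ (T% X) x) :
   ContMDiffAt 𝓘(ℝ, E) 𝓘(ℝ, ℝ) ∞ (fun y ↦ θ y (X y)) x := by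
  have h1 := ContMDiffAt.clm_bundle_apply (h x) hX
  exact (contMDiffAt_totalSpace).1 h1 |>.2
variable [FiniteDimensional ℝ E]


theorem IsSmoothForm.tensorial_right {θ : Π x : M, TangentSpace 𝓘(ℝ, E) x →L[ℝ] ℝ}
    (h : IsSmoothForm θ) (x : M) (X : Π x : M, TangentSpace 𝓘(ℝ, E) x) :
    TensorialAt 𝓘(ℝ, E) E (extDerivFields θ X · x) x where
  smul {f Y} hf hY := by
    have : CompleteSpace E := FiniteDimensional.complete ℝ E
    have e : (fun y ↦ θ y ((f • Y) y)) = f * (fun y ↦ θ y (Y y)) := by ext y; simp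
    have := mvfderiv_mul hf (h.apply_mdiff hY)
    simp only [extDerivFields, e, this, VectorField.mlieBracket_smul_right hf hY]
    simp
    ring
  add {Y Y'} hY hY' := by
    have : CompleteSpace E := FiniteDimensional.complete ℝ E
    have e : (fun y ↦ θ y ((Y + Y') y)) = (fun y ↦ θ y (Y y)) + (fun y ↦ θ y (Y' y)) := by
      ext y; simp
    have := mvfderiv_add (h.apply_mdiff hY) (h.apply_mdiff hY')
    simp only [extDerivFields, e, this, VectorField.mlieBracket_add_right hY hY']
    simp
    ring

theorem IsSmoothForm.tensorial_left {θ : Π x : M, TangentSpace 𝓘(ℝ, E) x →L[ℝ] ℝ}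
    (h : IsSmoothForm θ) (x : M) (Y : Π x : M, TangentSpace 𝓘(ℝ, E) x) :
    TensorialAt 𝓘(ℝ, E) E (extDerivFields θ · Y x) x where
  smul {f X} hf hX := by
    rw [extDerivFields_swap, (h.tensorial_right x Y).smul hf hX, extDerivFields_swap θ X]
    simp
  add {X X'} hX hX' := by
    rw [extDerivFields_swap, (h.tensorial_right x Y).add hX hX', extDerivFields_swap θ X,
      extDerivFields_swap θ X']
    ring

/-- The exterior derivative `dθ` of a smooth one-form, as a bilinear form on each tangent space:
`dθ(X, Y) = X(θ(Y)) - Y(θ(X)) - θ([X, Y])`. -/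
noncomputable def IsSmoothForm.d {θ : Π x : M, TangentSpace 𝓘(ℝ, E) x →L[ℝ] ℝ}
    (h : IsSmoothForm θ) (x : M) :
    TangentSpace 𝓘(ℝ, E) x →L[ℝ] TangentSpace 𝓘(ℝ, E) x →L[ℝ] ℝ :=
  TensorialAt.mkHom₂ (extDerivFields θ · · x) x
    (fun Y _ ↦ h.tensorial_left x Y) (fun X _ ↦ h.tensorial_right x X)

theorem IsSmoothForm.d_apply {θ : Π x : M, TangentSpace 𝓘(ℝ, E) x →L[ℝ] ℝ}
    (h : IsSmoothForm θ) {X Y : Π x : M, TangentSpace 𝓘(ℝ, E) x} {x : M}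
    (hX : MDiffAt (T% X) x) (hY : MDiffAt (T% Y) x) :
    h.d x (X x) (Y x) = extDerivFields θ X Y x :=
  TensorialAt.mkHom₂_apply _ _ hX hY

theorem IsSmoothForm.d_swap {θ : Π x : M, TangentSpace 𝓘(ℝ, E) x →L[ℝ] ℝ}
    (h : IsSmoothForm θ) (x : M) (v w : TangentSpace 𝓘(ℝ, E) x) :
    h.d x v w = - h.d x w v := by
  rw [IsSmoothForm.d, TensorialAt.mkHom₂_apply_eq_extend, TensorialAt.mkHom₂_apply_eq_extend]
  exact extDerivFields_swap _ _ _ _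

/-- `dθ(X, Y) = -θ([X, Y])` for sections `X`, `Y` of `ker θ`. -/
theorem IsSmoothForm.d_horizontal {θ : Π x : M, TangentSpace 𝓘(ℝ, E) x →L[ℝ] ℝ}
    (h : IsSmoothForm θ) (A B : Π y : M, (θ y).ker) {x : M}
    (hA : MDiffAt (T% (fun y ↦ (A y : TangentSpace 𝓘(ℝ, E) y))) x)
    (hB : MDiffAt (T% (fun y ↦ (B y : TangentSpace 𝓘(ℝ, E) y))) x) :
    h.d x (A x) (B x) = - θ x (VectorField.mlieBracket 𝓘(ℝ, E)
      (fun y ↦ (A y : TangentSpace 𝓘(ℝ, E) y)) (fun y ↦ B y) x) := by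
  rw [h.d_apply (X := fun y ↦ (A y : TangentSpace 𝓘(ℝ, E) y))
    (Y := fun y ↦ (B y : TangentSpace 𝓘(ℝ, E) y)) hA hB, extDerivFields]
  have a : (fun y ↦ θ y (A y)) = fun _ ↦ 0 := funext fun y ↦ (A y).2
  have b : (fun y ↦ θ y (B y)) = fun _ ↦ 0 := funext fun y ↦ (B y).2
  rw [a, b, mvfderiv_const]
  simp

end OneForms

theorem exists_orthonormal_basis {V : Type*} [AddCommGroup V] [Module ℝ V] [FiniteDimensional ℝ V]
    (B : V →ₗ[ℝ] V →ₗ[ℝ] ℝ) (symm : ∀ v w, B v w = B w v) (pos : ∀ v, v ≠ 0 → 0 < B v v)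
    {k : ℕ} (hk : Module.finrank ℝ V = k) :
    ∃ b : Module.Basis (Fin k) ℝ V, ∀ i j, B (b i) (b j) = if i = j then 1 else 0 := by
  have nn : ∀ v, 0 ≤ B v v := fun v ↦ by
    by_cases h : v = 0
    · simp [h]
    · exact (pos v h).le
  let c : InnerProductSpace.Core ℝ V :=
    { inner := fun v w ↦ B v w
      conj_inner_symm := fun v w ↦ by simp [symm v w]
      re_inner_nonneg := fun v ↦ by simpa using nn v
      add_left := fun u v w ↦ by simp
      smul_left := fun u v r ↦ by simp
      definite := fun v h ↦ by
        by_contra h0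
        exact (pos v h0).ne' h }
  let _ := c.toNormedAddCommGroup
  let _ : InnerProductSpace ℝ V := InnerProductSpace.ofCore c.toCore
  subst hk
  refine ⟨(stdOrthonormalBasis ℝ V).toBasis, fun i j ↦ ?_⟩
  have := orthonormal_iff_ite.1 (stdOrthonormalBasis ℝ V).orthonormal i j
  rw [OrthonormalBasis.coe_toBasis]
  exact this

/-- A strictly pseudoconvex CR manifold `(M, θ)` of CR dimension `n`: a smooth manifold of real
dimension `2n + 1` with a pseudo-Hermitian structure `θ`, whose kernel is the Levi distribution
`H(M)`, and an integrable complex structure `J` on `H(M)`, such that the Levi form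
`G_θ(X, Y) = -dθ(JX, Y)` is positive definite on `H(M)`. -/
structure StrictlyPseudoconvexCR (n : ℕ) (E : Type*) [NormedAddCommGroup E] [NormedSpace ℝ E]
    [FiniteDimensional ℝ E] (M : Type*) [TopologicalSpace M] [ChartedSpace E M]
    [IsManifold 𝓘(ℝ, E) ∞ M] where
  dim_eq : Module.finrank ℝ E = 2 * n + 1
  /-- The pseudo-Hermitian structure; its kernel is the Levi distribution. -/
  θ : Π x : M, TangentSpace 𝓘(ℝ, E) x →L[ℝ] ℝ
  θ_ne_zero : ∀ x, θ x ≠ 0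
  θ_smooth : IsSmoothForm θ
  /-- The complex structure on the Levi distribution. -/
  J : Π x : M, (θ x).ker →ₗ[ℝ] (θ x).ker
  J_J : ∀ x v, J x (J x v) = -v
  /-- `J` maps smooth sections of `H(M)` to smooth sections. -/
  J_smooth : ∀ (X : Π x : M, (θ x).ker) (x : M),
    CMDiffAt ∞ (T% (fun y ↦ (X y : TangentSpace 𝓘(ℝ, E) y))) x →
    CMDiffAt ∞ (T% (fun y ↦ (J y (X y) : TangentSpace 𝓘(ℝ, E) y))) x
  /-- For sections `X`, `Y` of `H(M)`, the field `[X, Y] - [JX, JY]` is a section of `H(M)` and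
  `[JX, Y] + [X, JY] = J([X, Y] - [JX, JY])`. -/
  integrable : ∀ (X Y : Π x : M, (θ x).ker) (x : M),
    CMDiffAt ∞ (T% (fun y ↦ (X y : TangentSpace 𝓘(ℝ, E) y))) x →
    CMDiffAt ∞ (T% (fun y ↦ (Y y : TangentSpace 𝓘(ℝ, E) y))) x →
    ∃ h : VectorField.mlieBracket 𝓘(ℝ, E) (fun y ↦ (X y : TangentSpace 𝓘(ℝ, E) y)) (fun y ↦ Y y) x
        - VectorField.mlieBracket 𝓘(ℝ, E) (fun y ↦ (J y (X y) : TangentSpace 𝓘(ℝ, E) y))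
          (fun y ↦ J y (Y y)) x ∈ (θ x).ker,
      VectorField.mlieBracket 𝓘(ℝ, E) (fun y ↦ (J y (X y) : TangentSpace 𝓘(ℝ, E) y))
          (fun y ↦ Y y) x
        + VectorField.mlieBracket 𝓘(ℝ, E) (fun y ↦ (X y : TangentSpace 𝓘(ℝ, E) y))
          (fun y ↦ J y (Y y)) x
        = J x ⟨_, h⟩
  levi_pos : ∀ x (v : (θ x).ker), v ≠ 0 → 0 < - θ_smooth.d x (J x v) v

namespace StrictlyPseudoconvexCR

variable {n : ℕ} {E : Type*} [NormedAddCommGroup E] [NormedSpace ℝ E] [FiniteDimensional ℝ E]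
  {M : Type*} [TopologicalSpace M] [ChartedSpace E M] [IsManifold 𝓘(ℝ, E) ∞ M]
  (S : StrictlyPseudoconvexCR n E M)

/-- The Levi distribution `H(M) = ker θ`. -/
noncomputable abbrev H (x : M) : Submodule ℝ (TangentSpace 𝓘(ℝ, E) x) := (S.θ x).ker

/-- The Levi form `G_θ(v, w) = -dθ(Jv, w)` on `H(M)`. -/
noncomputable def levi (x : M) : S.H x →ₗ[ℝ] S.H x →ₗ[ℝ] ℝ :=
  LinearMap.mk₂ ℝ (fun v w ↦ - S.θ_smooth.d x (S.J x v) w)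
    (fun _ _ _ ↦ by simp; ring) (fun _ _ _ ↦ by simp)
    (fun _ _ _ ↦ by simp; ring) (fun _ _ _ ↦ by simp)

/-- Every horizontal vector extends to a section of `H(M)` that is smooth near the point. -/
theorem exists_section (x : M) (v : S.H x) : ∃ X : Π y : M, S.H y, X x = v ∧
    CMDiffAt ∞ (T% (fun y ↦ (X y : TangentSpace 𝓘(ℝ, E) y))) x := by
  classical
  obtain ⟨u, hu⟩ : ∃ u, S.θ x u ≠ 0 := by
    by_contra! h
    exact S.θ_ne_zero x (ContinuousLinearMap.ext h)
  let U : Π y : M, TangentSpace 𝓘(ℝ, E) y := FiberBundle.extend E u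
  let V : Π y : M, TangentSpace 𝓘(ℝ, E) y := FiberBundle.extend E (v : TangentSpace 𝓘(ℝ, E) x)
  have hU : CMDiffAt ∞ (T% U) x := FiberBundle.contMDiffAt_extend _ _ _
  have hV : CMDiffAt ∞ (T% V) x := FiberBundle.contMDiffAt_extend _ _ _
  have hUx : U x = u := FiberBundle.extend_apply_self _ _
  have hVx : V x = v := FiberBundle.extend_apply_self _ _
  have hθU := S.θ_smooth.apply_smooth hU
  have hθV := S.θ_smooth.apply_smooth hV
  let W : Π y : M, TangentSpace 𝓘(ℝ, E) y :=
    V - (fun y ↦ S.θ y (V y) * (S.θ y (U y))⁻¹) • U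
  have hW : CMDiffAt ∞ (T% W) x := by
    refine hV.sub_section (ContMDiffAt.smul_section ?_ hU)
    exact hθV.mul (hθU.inv₀ (by simpa [hUx] using hu))
  have hmem : ∀ y, S.θ y (U y) ≠ 0 → W y ∈ S.H y := fun y hy ↦ by
    simp [W, H, hy]
  refine ⟨fun y ↦ if h : S.θ y (U y) ≠ 0 then ⟨W y, hmem y h⟩ else 0, ?_, ?_⟩
  · have h0 : S.θ x (U x) ≠ 0 := by simpa [hUx] using hu
    change (if h : S.θ x (U x) ≠ 0 then (⟨W x, hmem x h⟩ : S.H x) else 0) = v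
    rw [dif_pos h0]
    ext
    have : S.θ x v = 0 := v.2
    simp [W, hVx, this]
  · refine hW.congr_of_eventuallyEq ?_
    filter_upwards [hθU.continuousAt.eventually_ne (y := (0 : ℝ)) (by simpa [hUx] using hu)] with y hy
    simp [hy]

theorem d_J_J (x : M) (v w : S.H x) :
    S.θ_smooth.d x (S.J x v) (S.J x w) = S.θ_smooth.d x v w := by
  obtain ⟨X, rfl, hX⟩ := S.exists_section x v
  obtain ⟨Y, rfl, hY⟩ := S.exists_section x w
  have hJX := S.J_smooth X x hX
  have hJY := S.J_smooth Y x hY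
  obtain ⟨h, -⟩ := S.integrable X Y x hX hY
  have e1 := S.θ_smooth.d_horizontal X Y (hX.mdifferentiableAt (by simp))
    (hY.mdifferentiableAt (by simp))
  have e2 := S.θ_smooth.d_horizontal (fun y ↦ S.J y (X y)) (fun y ↦ S.J y (Y y))
    (hJX.mdifferentiableAt (by simp)) (hJY.mdifferentiableAt (by simp))
  rw [LinearMap.mem_ker, ContinuousLinearMap.coe_coe, map_sub, sub_eq_zero] at h
  rw [e1, h]
  exact e2

theorem levi_symm (x : M) (v w : S.H x) : S.levi x v w = S.levi x w v := by
  have h := S.d_J_J x v (S.J x w)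
  have hJ : S.J x (S.J x w) = -w := S.J_J x w
  rw [hJ] at h
  have h2 := S.θ_smooth.d_swap x v (S.J x w)
  simp only [levi, LinearMap.mk₂_apply]
  simp at h
  rw [h, h2]

theorem levi_posDef (x : M) (v : S.H x) (hv : v ≠ 0) : 0 < S.levi x v v := S.levi_pos x v hv

theorem finrank_H (x : M) : Module.finrank ℝ (S.H x) = 2 * n := by
  have : FiniteDimensional ℝ (TangentSpace 𝓘(ℝ, E) x) := inferInstanceAs (FiniteDimensional ℝ E)
  have h := (S.θ x : TangentSpace 𝓘(ℝ, E) x →ₗ[ℝ] ℝ).finrank_range_add_finrank_ker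
  have hs : (S.θ x : TangentSpace 𝓘(ℝ, E) x →ₗ[ℝ] ℝ).range = ⊤ := by
    refine LinearMap.range_eq_top.2 (LinearMap.surjective ?_)
    intro h0
    exact S.θ_ne_zero x (ContinuousLinearMap.ext fun v ↦ congrArg (fun l ↦ l v) h0)
  have hd : Module.finrank ℝ (TangentSpace 𝓘(ℝ, E) x) = 2 * n + 1 := S.dim_eq
  rw [hs, finrank_top, Module.finrank_self, hd] at h
  have : Module.finrank ℝ (S.H x) = Module.finrank ℝ (S.θ x).ker := rfl
  omega

theorem exists_frame (x : M) : ∃ e : Module.Basis (Fin (2 * n)) ℝ (S.H x),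
    ∀ i j, S.levi x (e i) (e j) = if i = j then 1 else 0 :=
  have : FiniteDimensional ℝ (TangentSpace 𝓘(ℝ, E) x) := inferInstanceAs (FiniteDimensional ℝ E)
  exists_orthonormal_basis (S.levi x) (S.levi_symm x) (S.levi_posDef x) (S.finrank_H x)

/-- A `G_θ`-orthonormal basis of `H_x(M)`. -/
noncomputable def frame (x : M) : Module.Basis (Fin (2 * n)) ℝ (S.H x) := (S.exists_frame x).choose

theorem frame_orthonormal (x : M) (i j : Fin (2 * n)) :
    S.levi x (S.frame x i) (S.frame x j) = if i = j then 1 else 0 := (S.exists_frame x).choose_spec i j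

theorem existsUnique_reeb (x : M) : ∃! v : TangentSpace 𝓘(ℝ, E) x,
    S.θ x v = 1 ∧ ∀ w, S.θ_smooth.d x v w = 0 := by
  have : FiniteDimensional ℝ (TangentSpace 𝓘(ℝ, E) x) := inferInstanceAs (FiniteDimensional ℝ E)
  have dself : ∀ v, S.θ_smooth.d x v v = 0 := fun v ↦ by
    have := S.θ_smooth.d_swap x v v
    linarith
  obtain ⟨u, hu⟩ : ∃ u, S.θ x u = 1 := by
    obtain ⟨u, hu⟩ : ∃ u, S.θ x u ≠ 0 := by
      by_contra! h
      exact S.θ_ne_zero x (ContinuousLinearMap.ext h)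
    exact ⟨(S.θ x u)⁻¹ • u, by simp [hu]⟩
  let A : S.H x →ₗ[ℝ] Module.Dual ℝ (S.H x) :=
    LinearMap.mk₂ ℝ (fun v w : S.H x ↦ S.θ_smooth.d x v w)
      (fun _ _ _ ↦ by simp) (fun _ _ _ ↦ by simp) (fun _ _ _ ↦ by simp) (fun _ _ _ ↦ by simp)
  have hA : Function.Injective A := by
    rw [injective_iff_map_eq_zero]
    intro v hv
    by_contra h0
    have h1 := S.levi_pos x v h0
    have h2 : S.θ_smooth.d x v (S.J x v) = 0 := congrArg (fun l ↦ l (S.J x v)) hv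
    rw [S.θ_smooth.d_swap, h2] at h1
    simp at h1
  have hAs : Function.Surjective A :=
    (LinearMap.injective_iff_surjective_of_finrank_eq_finrank
      (Subspace.dual_finrank_eq (K := ℝ) (V := S.H x)).symm).1 hA
  obtain ⟨h, hh⟩ := hAs ((S.θ_smooth.d x u : TangentSpace 𝓘(ℝ, E) x →ₗ[ℝ] ℝ) ∘ₗ (S.H x).subtype)
  have hh' : ∀ w : S.H x, S.θ_smooth.d x h w = S.θ_smooth.d x u w :=
    fun w ↦ congrArg (fun l ↦ l w) hh
  have hθh : S.θ x h = 0 := h.2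
  have split : ∀ v : TangentSpace 𝓘(ℝ, E) x, S.θ x v = 1 → (∀ w : S.H x, S.θ_smooth.d x v w = 0) →
      ∀ w, S.θ_smooth.d x v w = 0 := fun v h1 h2 w ↦ by
    have hm : w - S.θ x w • v ∈ S.H x := by simp [H, h1]
    have := h2 ⟨_, hm⟩
    simpa [dself] using this
  refine ⟨u - h, ⟨by simp [hu, hθh], split _ (by simp [hu, hθh]) fun w ↦ ?_⟩, ?_⟩
  · simp [hh']
  · rintro v ⟨hv1, hv2⟩
    have hm : v - (u - h) ∈ S.H x := by simp [H, hv1, hu, hθh]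
    have h0 : (⟨_, hm⟩ : S.H x) = 0 := by
      apply hA
      rw [map_zero]
      ext w
      change S.θ_smooth.d x (v - (u - h)) w = 0
      simp [hv2, hh']
    have := congrArg Subtype.val h0
    exact sub_eq_zero.1 this

/-- The Reeb vector field `ξ`: `θ(ξ) = 1` and `dθ(ξ, ·) = 0`. -/
noncomputable def reeb (x : M) : TangentSpace 𝓘(ℝ, E) x := (S.existsUnique_reeb x).choose

theorem reeb_spec (x : M) : S.θ x (S.reeb x) = 1 ∧ ∀ w, S.θ_smooth.d x (S.reeb x) w = 0 :=
  (S.existsUnique_reeb x).choose_spec.1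

/-- The projection `v ↦ v^H` onto `H(M)` along the Reeb field. -/
noncomputable def horizontal (x : M) (v : TangentSpace 𝓘(ℝ, E) x) : S.H x :=
  ⟨v - S.θ x v • S.reeb x, by simp [H, S.reeb_spec x]⟩

/-- The Webster metric `g_θ(v, w) = G_θ(v^H, w^H) + θ(v)θ(w)`. -/
noncomputable def webster (x : M) (v w : TangentSpace 𝓘(ℝ, E) x) : ℝ :=
  S.levi x (S.horizontal x v) (S.horizontal x w) + S.θ x v * S.θ x w

/-- `∇` is the Tanaka-Webster connection of `(M, θ)`: the tensors `θ`, `dθ` and `J` are parallel,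
and the torsion satisfies `T(X, Y) = -θ([X, Y])ξ` and `T(ξ, JX) = -J T(ξ, X) ∈ H(M)` for horizontal
`X`, `Y`. In Mathlib's convention `D Y x v` is `(∇_v Y)(x)`. -/
structure IsTanakaWebster
    (D : CovariantDerivative 𝓘(ℝ, E) E (TangentSpace 𝓘(ℝ, E) : M → Type _)) : Prop where
  parallel_θ : ∀ (Y : Π x : M, TangentSpace 𝓘(ℝ, E) x) (x : M), MDiffAt (T% Y) x →
    ∀ v, mvfderiv 𝓘(ℝ, E) (fun y ↦ S.θ y (Y y)) x v = S.θ x (D Y x v)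
  parallel_dθ : ∀ (Y Z : Π x : M, TangentSpace 𝓘(ℝ, E) x) (x : M),
    MDiffAt (T% Y) x → MDiffAt (T% Z) x →
    ∀ v, mvfderiv 𝓘(ℝ, E) (fun y ↦ S.θ_smooth.d y (Y y) (Z y)) x v =
      S.θ_smooth.d x (D Y x v) (Z x) + S.θ_smooth.d x (Y x) (D Z x v)
  parallel_J : ∀ (Y : Π x : M, S.H x) (x : M),
    MDiffAt (T% (fun y ↦ (Y y : TangentSpace 𝓘(ℝ, E) y))) x →
    ∀ v, ∃ h : D (fun y ↦ (Y y : TangentSpace 𝓘(ℝ, E) y)) x v ∈ S.H x,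
      D (fun y ↦ (S.J y (Y y) : TangentSpace 𝓘(ℝ, E) y)) x v = S.J x ⟨_, h⟩
  torsion_horizontal : ∀ (X Y : Π x : M, S.H x) (x : M),
    MDiffAt (T% (fun y ↦ (X y : TangentSpace 𝓘(ℝ, E) y))) x →
    MDiffAt (T% (fun y ↦ (Y y : TangentSpace 𝓘(ℝ, E) y))) x →
    D.torsion x (X x) (Y x) = - S.θ x (VectorField.mlieBracket 𝓘(ℝ, E)
      (fun y ↦ (X y : TangentSpace 𝓘(ℝ, E) y)) (fun y ↦ Y y) x) • S.reeb x
  torsion_reeb : ∀ (x : M) (v : S.H x),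
    ∃ h : D.torsion x (S.reeb x) v ∈ S.H x,
      D.torsion x (S.reeb x) (S.J x v) = - (S.J x ⟨_, h⟩ : TangentSpace 𝓘(ℝ, E) x)

/-- The trace with respect to `G_θ` of a bilinear map `B` on `H_x(M)`, namely `∑ B(e_i, e_i)` for a
`G_θ`-orthonormal basis `(e_i)` of `H_x(M)`; it does not depend on the basis. -/
noncomputable def trace {W : Type*} [AddCommMonoid W] (x : M)
    (B : TangentSpace 𝓘(ℝ, E) x → TangentSpace 𝓘(ℝ, E) x → W) : W :=
  ∑ i, B (S.frame x i) (S.frame x i)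


/-- The Hessian `(∇du)(v, w)` of a function with respect to a connection: it is
`v(W(u)) - (∇_v W)(u)` for any vector field `W` extending `w`. -/
noncomputable def hessian (D : CovariantDerivative 𝓘(ℝ, E) E (TangentSpace 𝓘(ℝ, E) : M → Type _))
    (u : M → ℝ) (x : M) (v w : TangentSpace 𝓘(ℝ, E) x) : ℝ :=
  mvfderiv 𝓘(ℝ, E) (fun y ↦ mvfderiv 𝓘(ℝ, E) u y (FiberBundle.extend E w y)) x v
    - mvfderiv 𝓘(ℝ, E) u x (D (FiberBundle.extend E w) x v)

/-- The sub-Laplacian `Δ_b u = trace_{G_θ} ∇du`, where `∇` is the Tanaka-Webster connection. -/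
noncomputable def subLaplacian
    (D : CovariantDerivative 𝓘(ℝ, E) E (TangentSpace 𝓘(ℝ, E) : M → Type _))
    (u : M → ℝ) (x : M) : ℝ :=
  S.trace x (hessian D u x)

section Maps

variable {E' : Type*} [NormedAddCommGroup E'] [NormedSpace ℝ E']
  {N : Type*} [TopologicalSpace N] [ChartedSpace E' N] [IsManifold 𝓘(ℝ, E') ∞ N]

/-- The pull-back `∇^f` to `f⁻¹TN` of a connection on `TN`. In the constant frame `(∂_i)` of a
local trivialization of `TN` around `f x`, a section `V = ∑ s_i ∂_i` along `f` satisfies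
`∇^f_v V = ∑ ds_i(v) ∂_i + ∑ s_i(x) ∇_{df(v)} ∂_i`. -/
noncomputable def pullbackCov
    (D' : CovariantDerivative 𝓘(ℝ, E') E' (TangentSpace 𝓘(ℝ, E') : N → Type _))
    (f : M → N) (V : Π y : M, TangentSpace 𝓘(ℝ, E') (f y)) (x : M) (v : TangentSpace 𝓘(ℝ, E) x) :
    TangentSpace 𝓘(ℝ, E') (f x) :=
  (trivializationAt E' (TangentSpace 𝓘(ℝ, E') : N → Type _) (f x)).symm (f x)
      (mvfderiv 𝓘(ℝ, E) (fun y ↦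
        (trivializationAt E' (TangentSpace 𝓘(ℝ, E') : N → Type _) (f x) ⟨f y, V y⟩).2) x v)
    + D' (FiberBundle.extend E' (V x)) (f x) (mfderiv 𝓘(ℝ, E) 𝓘(ℝ, E') f x v)

/-- The form `β_f(v, w) = ∇^f_v df(W) - df(∇_v W)`, for any vector field `W` extending `w`. -/
noncomputable def beta (D : CovariantDerivative 𝓘(ℝ, E) E (TangentSpace 𝓘(ℝ, E) : M → Type _))
    (D' : CovariantDerivative 𝓘(ℝ, E') E' (TangentSpace 𝓘(ℝ, E') : N → Type _))
    (f : M → N) (x : M) (v w : TangentSpace 𝓘(ℝ, E) x) : TangentSpace 𝓘(ℝ, E') (f x) :=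
  pullbackCov D' f (fun y ↦ mfderiv 𝓘(ℝ, E) 𝓘(ℝ, E') f y (FiberBundle.extend E w y)) x v
    - mfderiv 𝓘(ℝ, E) 𝓘(ℝ, E') f x (D (FiberBundle.extend E w) x v)

/-- The Levi tension `H_b(f) = trace_{G_θ} β_f` of a map `f` from `(M, θ)` to a Riemannian manifold,
where `D` is the Tanaka-Webster connection and `D'` is the Levi-Civita connection of the target. -/
noncomputable def leviTension
    (D : CovariantDerivative 𝓘(ℝ, E) E (TangentSpace 𝓘(ℝ, E) : M → Type _))
    (D' : CovariantDerivative 𝓘(ℝ, E') E' (TangentSpace 𝓘(ℝ, E') : N → Type _))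
    (f : M → N) (x : M) : TangentSpace 𝓘(ℝ, E') (f x) :=
  S.trace x (beta D D' f x)

end Maps

end StrictlyPseudoconvexCR

/-- `D` is the Levi-Civita connection of the metric `g`: it is torsion-free and `g` is parallel. -/
structure IsLeviCivita {E : Type*} [NormedAddCommGroup E] [NormedSpace ℝ E] [FiniteDimensional ℝ E]
    {N : Type*} [TopologicalSpace N] [ChartedSpace E N] [IsManifold 𝓘(ℝ, E) ∞ N]
    (g : Π p : N, TangentSpace 𝓘(ℝ, E) p → TangentSpace 𝓘(ℝ, E) p → ℝ)
    (D : CovariantDerivative 𝓘(ℝ, E) E (TangentSpace 𝓘(ℝ, E) : N → Type _)) : Prop where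
  torsion_free : D.torsion = 0
  metric : ∀ (Y Z : Π p : N, TangentSpace 𝓘(ℝ, E) p) (p : N),
    MDiffAt (T% Y) p → MDiffAt (T% Z) p →
    ∀ v, mvfderiv 𝓘(ℝ, E) (fun q ↦ g q (Y q) (Z q)) p v = g p (D Y p v) (Z p) + g p (Y p) (D Z p v)


section VectorSpace

variable {F : Type*} [NormedAddCommGroup F] [NormedSpace ℝ F]

theorem mdiffAt_vectorSpace {V : F → F} {p : F} :
    MDifferentiableAt 𝓘(ℝ, F) 𝓘(ℝ, F).tangent
      (fun q ↦ TotalSpace.mk' F (E := (TangentSpace 𝓘(ℝ, F) : F → Type _)) q (V q)) p ↔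
    DifferentiableAt ℝ V p := by
  rw [mdifferentiableAt_totalSpace]
  simp [mdifferentiableAt_iff_differentiableAt]

theorem mlieBracket_vectorSpace (V W : F → F) (p : F) :
    VectorField.mlieBracket 𝓘(ℝ, F) (V : Π q : F, TangentSpace 𝓘(ℝ, F) q) W p =
      (fderiv ℝ W p (V p) - fderiv ℝ V p (W p) : F) := by
  have h1 := congrFun (VectorField.mlieBracketWithin_eq_lieBracketWithin (𝕜 := ℝ) (V := V) (W := W)
    (s := Set.univ)) p
  have h2 := congrFun (VectorField.mlieBracketWithin_univ (I := 𝓘(ℝ, F)) (V := V) (W := W)) p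
  exact h2.symm.trans (h1.trans (congrFun VectorField.lieBracketWithin_univ p))

theorem isSmoothForm_vectorSpace {θ : F → F →L[ℝ] ℝ} (h : ContDiff ℝ ∞ θ) :
    IsSmoothForm (E := F) (M := F) θ := by
  intro p
  rw [contMDiffAt_hom_bundle]
  refine ⟨contMDiffAt_id, ?_⟩
  have := h.contMDiff p
  refine this.congr_of_eventuallyEq (Filter.Eventually.of_forall fun q ↦ ?_)
  have e1 := TangentBundle.symmL_model_space (𝕜 := ℝ) (F := F) p q
  simp only [ContinuousLinearMap.inCoordinates]
  erw [e1, Trivial.continuousLinearMapAt_trivialization]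
  rfl

theorem d_vectorSpace [FiniteDimensional ℝ F] {θ : F → F →L[ℝ] ℝ} (h : ContDiff ℝ ∞ θ) (p v w : F) :
    (isSmoothForm_vectorSpace h).d p v w = fderiv ℝ θ p v w - fderiv ℝ θ p w v := by
  have hd : ∀ u : F, MDifferentiableAt 𝓘(ℝ, F) 𝓘(ℝ, F).tangent
      (fun q ↦ TotalSpace.mk' F (E := (TangentSpace 𝓘(ℝ, F) : F → Type _)) q u) p :=
    fun u ↦ mdiffAt_vectorSpace.2 (differentiableAt_const u)
  refine ((isSmoothForm_vectorSpace h).d_apply (hd v) (hd w)).trans ?_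
  have e : ∀ u a : F, mvfderiv 𝓘(ℝ, F) (fun q ↦ θ q u) p a = fderiv ℝ θ p a u := fun u a ↦ by
    have h1 : mvfderiv 𝓘(ℝ, F) (fun q ↦ θ q u) p a = fderiv ℝ (fun q ↦ θ q u) p a := by
      simp only [mvfderiv, mfderiv_eq_fderiv]
      rfl
    rw [h1]
    have h2 := ((h.differentiable (by simp)) p).hasFDerivAt.clm_apply (hasFDerivAt_const u p)
    rw [h2.fderiv]
    simp
  have hb : VectorField.mlieBracket 𝓘(ℝ, F) (fun _ : F ↦ v : Π q : F, TangentSpace 𝓘(ℝ, F) q)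
      (fun _ : F ↦ w) p = 0 := by
    refine (mlieBracket_vectorSpace (fun _ : F ↦ v) (fun _ ↦ w) p).trans ?_
    rw [fderiv_fun_const, fderiv_fun_const]
    exact sub_self (0 : F)
  unfold extDerivFields
  erw [hb, e, e, map_zero, sub_zero]

end VectorSpace

/-- The space `ℂᵐ × ℝ` underlying the Heisenberg group `ℍᵐ`. -/
abbrev Heis (m : ℕ) : Type := (Fin m → ℂ) × ℝ

namespace Heis

variable {m : ℕ}

/-- The left-invariant vector field `X_j = ∂/∂x_j + 2 y_j ∂/∂t`. -/
def X (j : Fin m) (p : Heis m) : TangentSpace 𝓘(ℝ, Heis m) p :=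
  ((Pi.single j 1, 2 * (p.1 j).im) : Heis m)

/-- The left-invariant vector field `Y_j = ∂/∂y_j - 2 x_j ∂/∂t`. -/
def Y (j : Fin m) (p : Heis m) : TangentSpace 𝓘(ℝ, Heis m) p :=
  ((Pi.single j Complex.I, -2 * (p.1 j).re) : Heis m)

/-- The standard form `θ = dt + 2 ∑ (x_j dy_j - y_j dx_j)`, at the point `p`. -/
noncomputable def form (p : Heis m) : Heis m →L[ℝ] ℝ :=
  ContinuousLinearMap.snd ℝ (Fin m → ℂ) ℝ + (2 : ℝ) • ∑ j,
    ((p.1 j).re • (Complex.imCLM ∘L ContinuousLinearMap.proj j ∘L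
        ContinuousLinearMap.fst ℝ (Fin m → ℂ) ℝ)
      - (p.1 j).im • (Complex.reCLM ∘L ContinuousLinearMap.proj j ∘L
        ContinuousLinearMap.fst ℝ (Fin m → ℂ) ℝ))

theorem form_apply (p v : Heis m) :
    form p v = v.2 + 2 * ∑ j, ((p.1 j).re * (v.1 j).im - (p.1 j).im * (v.1 j).re) := by
  simp [form]

theorem form_contDiff : ContDiff ℝ ∞ (form : Heis m → Heis m →L[ℝ] ℝ) := by
  unfold form
  have h1 : ∀ j : Fin m, ContDiff ℝ ∞ (fun p : Heis m ↦ (p.1 j).re) := fun j ↦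
    (Complex.reCLM ∘L ContinuousLinearMap.proj (R := ℝ) (φ := fun _ : Fin m ↦ ℂ) j ∘L
        ContinuousLinearMap.fst ℝ (Fin m → ℂ) ℝ).contDiff
  have h2 : ∀ j : Fin m, ContDiff ℝ ∞ (fun p : Heis m ↦ (p.1 j).im) := fun j ↦
    (Complex.imCLM ∘L ContinuousLinearMap.proj (R := ℝ) (φ := fun _ : Fin m ↦ ℂ) j ∘L
        ContinuousLinearMap.fst ℝ (Fin m → ℂ) ℝ).contDiff
  fun_prop

/-- The complex structure on `H(ℍᵐ)`, which acts on the `ℂᵐ` component as multiplication by `i`;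
in particular `J X_j = Y_j`. -/
noncomputable def cplx (p : Heis m) : Heis m →ₗ[ℝ] Heis m where
  toFun v := (Complex.I • v.1, -2 * ∑ j, ((p.1 j).re * (v.1 j).re + (p.1 j).im * (v.1 j).im))
  map_add' v w := by
    ext
    · simp [mul_add]
    · simp [mul_add, Finset.sum_add_distrib]
      ring
  map_smul' a v := by
    ext
    · simp
      ring
    · simp only [Prod.smul_fst, Prod.smul_snd, Pi.smul_apply, Complex.smul_re, Complex.smul_im,
        smul_eq_mul, RingHom.id_apply, Finset.mul_sum]
      exact Finset.sum_congr rfl fun j _ ↦ by ring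

theorem cplx_mem (p v : Heis m) : form p (cplx p v) = 0 := by
  simp only [form_apply, cplx, LinearMap.coe_mk, AddHom.coe_mk, Pi.smul_apply, smul_eq_mul,
    Complex.mul_re, Complex.mul_im, Complex.I_re, Complex.I_im, zero_mul, one_mul, zero_sub,
    zero_add, mul_neg, sub_neg_eq_add]
  ring

/-- Horizontal vectors are determined by their `ℂᵐ` component. -/
theorem ext_of_form {p v w : Heis m} (hv : form p v = 0) (hw : form p w = 0) (h : v.1 = w.1) :
    v = w := by
  rw [form_apply] at hv hw
  rw [h] at hv
  exact Prod.ext h (by linarith)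

theorem cplx_cplx {p v : Heis m} (hv : form p v = 0) : cplx p (cplx p v) = -v := by
  refine ext_of_form (cplx_mem _ _) (by simp [hv]) ?_
  ext j
  simp [cplx, ← mul_assoc]

theorem fderiv_form (p v w : Heis m) :
    fderiv ℝ form p v w = 2 * ∑ j, ((v.1 j).re * (w.1 j).im - (v.1 j).im * (w.1 j).re) := by
  have h := (form_contDiff.differentiable (by simp) p).hasFDerivAt.clm_apply (hasFDerivAt_const w p)
  have e : (fun q : Heis m ↦ form q w) = fun q ↦ w.2 + (ContinuousLinearMap.snd ℝ _ ℝ q - form w q) := by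
    funext q
    simp only [form_apply, ContinuousLinearMap.coe_snd', sub_add_cancel_left, ← mul_neg, ← Finset.sum_neg_distrib]
    congr 2
    exact Finset.sum_congr rfl fun j _ ↦ by ring
  have h' : HasFDerivAt (fun q : Heis m ↦ form q w) (ContinuousLinearMap.snd ℝ _ ℝ - form w) p := by
    rw [e]
    exact (ContinuousLinearMap.snd ℝ (Fin m → ℂ) ℝ - form w).hasFDerivAt.const_add _
  have := congrArg (fun l ↦ l v) (h.unique h')
  simp at this
  rw [this, form_apply, sub_add_cancel_left, ← mul_neg, ← Finset.sum_neg_distrib]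
  congr 1
  exact Finset.sum_congr rfl fun j _ ↦ by ring

theorem d_form (p v w : Heis m) : (isSmoothForm_vectorSpace form_contDiff).d p v w =
    4 * ∑ j, ((v.1 j).re * (w.1 j).im - (v.1 j).im * (w.1 j).re) := by
  refine (d_vectorSpace form_contDiff p v w).trans ?_
  rw [fderiv_form, fderiv_form, ← mul_sub, ← Finset.sum_sub_distrib, Finset.mul_sum, Finset.mul_sum]
  exact Finset.sum_congr rfl fun j _ ↦ by ring

theorem levi_form (p v w : Heis m) :
    - (isSmoothForm_vectorSpace form_contDiff).d p (cplx p v) w =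
      4 * ∑ j, ((v.1 j).re * (w.1 j).re + (v.1 j).im * (w.1 j).im) := by
  rw [d_form, ← mul_neg, ← Finset.sum_neg_distrib]
  congr 1
  exact Finset.sum_congr rfl fun j _ ↦ by simp [cplx]

theorem cplx_contDiffAt {V : Heis m → Heis m} {p : Heis m} (h : ContDiffAt ℝ ∞ V p) :
    ContDiffAt ℝ ∞ (fun q ↦ cplx q (V q)) p := by
  have h1 : ∀ j : Fin m, ContDiff ℝ ∞ (fun p : Heis m ↦ (p.1 j).re) := fun j ↦
    (Complex.reCLM ∘L ContinuousLinearMap.proj (R := ℝ) (φ := fun _ : Fin m ↦ ℂ) j ∘L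
        ContinuousLinearMap.fst ℝ (Fin m → ℂ) ℝ).contDiff
  have h2 : ∀ j : Fin m, ContDiff ℝ ∞ (fun p : Heis m ↦ (p.1 j).im) := fun j ↦
    (Complex.imCLM ∘L ContinuousLinearMap.proj (R := ℝ) (φ := fun _ : Fin m ↦ ℂ) j ∘L
        ContinuousLinearMap.fst ℝ (Fin m → ℂ) ℝ).contDiff
  have h3 : ∀ j : Fin m, ContDiffAt ℝ ∞ (fun q ↦ ((V q).1 j).re) p := fun j ↦ (h1 j).contDiffAt.comp p h
  have h4 : ∀ j : Fin m, ContDiffAt ℝ ∞ (fun q ↦ ((V q).1 j).im) p := fun j ↦ (h2 j).contDiffAt.comp p h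
  refine ContDiffAt.prodMk (h.fst.const_smul Complex.I) ?_
  refine contDiffAt_const.mul (ContDiffAt.sum fun j _ ↦ ?_)
  exact ((h1 j).contDiffAt.mul (h3 j)).add ((h2 j).contDiffAt.mul (h4 j))

/-- The bracket `[V, W] = DW(V) - DV(W)` of vector fields. -/
noncomputable def bracket (V W : Heis m → Heis m) (p : Heis m) : Heis m :=
  fderiv ℝ W p (V p) - fderiv ℝ V p (W p)

theorem form_bracket {V W : Heis m → Heis m} (hV : ∀ q, form q (V q) = 0)
    (hW : ∀ q, form q (W q) = 0) {p : Heis m} (dV : DifferentiableAt ℝ V p)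
    (dW : DifferentiableAt ℝ W p) :
    form p (bracket V W p) = -4 * ∑ j, (((V p).1 j).re * ((W p).1 j).im
      - ((V p).1 j).im * ((W p).1 j).re) := by
  have h := (isSmoothForm_vectorSpace form_contDiff).d_horizontal (fun q ↦ ⟨V q, hV q⟩)
    (fun q ↦ ⟨W q, hW q⟩) (mdiffAt_vectorSpace.2 dV) (mdiffAt_vectorSpace.2 dW)
  have h2 := (d_form p (V p) (W p)).symm.trans h
  erw [mlieBracket_vectorSpace V W p] at h2
  rw [neg_mul, h2, neg_neg]
  rfl

theorem bracket_fst {V W : Heis m → Heis m} {p : Heis m} (dV : DifferentiableAt ℝ V p)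
    (dW : DifferentiableAt ℝ W p) :
    (bracket V W p).1 = fderiv ℝ (fun q ↦ (W q).1) p (V p) - fderiv ℝ (fun q ↦ (V q).1) p (W p) := by
  rw [dV.hasFDerivAt.fst.fderiv, dW.hasFDerivAt.fst.fderiv]
  rfl

theorem integrable {V W : Heis m → Heis m} (hV : ∀ q, form q (V q) = 0)
    (hW : ∀ q, form q (W q) = 0) {p : Heis m} (dV : ContDiffAt ℝ ∞ V p)
    (dW : ContDiffAt ℝ ∞ W p) :
    form p (bracket V W p - bracket (fun q ↦ cplx q (V q)) (fun q ↦ cplx q (W q)) p) = 0 ∧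
    bracket (fun q ↦ cplx q (V q)) W p + bracket V (fun q ↦ cplx q (W q)) p =
      cplx p (bracket V W p - bracket (fun q ↦ cplx q (V q)) (fun q ↦ cplx q (W q)) p) := by
  have dV' := dV.differentiableAt (by simp)
  have dW' := dW.differentiableAt (by simp)
  have dJV := (cplx_contDiffAt dV).differentiableAt (by simp)
  have dJW := (cplx_contDiffAt dW).differentiableAt (by simp)
  have hJV : ∀ q, form q (cplx q (V q)) = 0 := fun q ↦ cplx_mem _ _
  have hJW : ∀ q, form q (cplx q (W q)) = 0 := fun q ↦ cplx_mem _ _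
  have eJ : ∀ q v : Heis m, (cplx q v).1 = Complex.I • v.1 := fun _ _ ↦ rfl
  refine ⟨?_, ext_of_form ?_ (cplx_mem _ _) ?_⟩
  · rw [map_sub, form_bracket hV hW dV' dW', form_bracket hJV hJW dJV dJW, ← mul_sub,
      ← Finset.sum_sub_distrib]
    simp only [eJ, Pi.smul_apply, smul_eq_mul, Complex.mul_re, Complex.mul_im, Complex.I_re,
      Complex.I_im]
    rw [Finset.sum_eq_zero, mul_zero]
    intro j _
    ring
  · rw [map_add, form_bracket hJV hW dJV dW', form_bracket hV hJW dV' dJW, ← mul_add,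
      ← Finset.sum_add_distrib]
    simp only [eJ, Pi.smul_apply, smul_eq_mul, Complex.mul_re, Complex.mul_im, Complex.I_re,
      Complex.I_im]
    rw [Finset.sum_eq_zero, mul_zero]
    intro j _
    ring
  · have sV := dV'.hasFDerivAt.fst.fun_const_smul Complex.I
    have sW := dW'.hasFDerivAt.fst.fun_const_smul Complex.I
    have qI : ∀ u : Fin m → ℂ, Complex.I • Complex.I • u = -u := fun u ↦ by
      rw [smul_smul, Complex.I_mul_I, neg_one_smul]
    rw [eJ, Prod.fst_add, Prod.fst_sub, bracket_fst dJV dW', bracket_fst dV' dJW,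
      bracket_fst dV' dW', bracket_fst dJV dJW]
    simp only [eJ]
    rw [sV.fderiv, sW.fderiv, dV'.hasFDerivAt.fst.fderiv, dW'.hasFDerivAt.fst.fderiv]
    simp only [smul_apply, smul_sub, qI]
    abel

/-- The Heisenberg group `ℍᵐ` with its standard pseudo-Hermitian structure. -/
noncomputable def cr (m : ℕ) : StrictlyPseudoconvexCR m (Heis m) (Heis m) where
  dim_eq := by
    simp [Module.finrank_prod, Module.finrank_pi_fintype]
    ring
  θ := form
  θ_ne_zero p h := by
    have := congrArg (fun l ↦ l ((0, 1) : Heis m)) h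
    change form p ((0, 1) : Heis m) = 0 at this
    simp [form_apply] at this
  θ_smooth := isSmoothForm_vectorSpace form_contDiff
  J p := (cplx p).restrict (p := (form p).ker) (q := (form p).ker) fun v _ ↦ cplx_mem p v
  J_J p v := Subtype.ext (cplx_cplx v.2)
  J_smooth X p hX := contMDiffAt_vectorSpace_iff_contDiffAt.2
    (cplx_contDiffAt (V := fun q ↦ (X q).1) (contMDiffAt_vectorSpace_iff_contDiffAt.1 hX))
  integrable X Y p hX hY := by
    obtain ⟨h1, h2⟩ := integrable (V := fun q ↦ (X q).1) (W := fun q ↦ (Y q).1) (fun q ↦ (X q).2)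
      (fun q ↦ (Y q).2) (p := p) (contMDiffAt_vectorSpace_iff_contDiffAt.1 hX)
      (contMDiffAt_vectorSpace_iff_contDiffAt.1 hY)
    have b1 := mlieBracket_vectorSpace (fun q ↦ (X q).1) (fun q ↦ (Y q).1) p
    have b2 := mlieBracket_vectorSpace (fun q ↦ cplx q (X q).1) (fun q ↦ cplx q (Y q).1) p
    have b3 := mlieBracket_vectorSpace (fun q ↦ cplx q (X q).1) (fun q ↦ (Y q).1) p
    have b4 := mlieBracket_vectorSpace (fun q ↦ (X q).1) (fun q ↦ cplx q (Y q).1) p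
    refine ⟨(congrArg (form p) (congrArg₂ (· - ·) b1 b2)).trans h1, ?_⟩
    refine (congrArg₂ (· + ·) b3 b4).trans (h2.trans ?_)
    exact (congrArg (cplx p) (congrArg₂ (· - ·) b1 b2)).symm
  levi_pos p v hv := by
    refine lt_of_lt_of_eq ?_ (levi_form p v.1 v.1).symm
    have hne : (v.1 : Heis m).1 ≠ 0 := fun h ↦ hv (Subtype.ext
      (ext_of_form (p := p) v.2 (map_zero (form p)) h))
    obtain ⟨j, hj⟩ := Function.ne_iff.1 hne
    refine mul_pos (by norm_num) (Finset.sum_pos' (fun i _ ↦ add_nonneg (mul_self_nonneg _) (mul_self_nonneg _)) ⟨j, Finset.mem_univ _, ?_⟩)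
    have := Complex.normSq_pos.2 hj
    rwa [Complex.normSq_apply] at this

/-- The Reeb field of `ℍᵐ` is `∂/∂t`. -/
theorem cr_reeb (p : Heis m) : (cr m).reeb p = ((0, 1) : Heis m) := by
  refine ((cr m).existsUnique_reeb p).unique ((cr m).reeb_spec p) ⟨?_, fun w ↦ ?_⟩
  · change form p ((0, 1) : Heis m) = 1
    simp [form_apply]
  · refine (d_form p ((0, 1) : Heis m) w).trans ?_
    simp

/-- The Webster metric of `ℍᵐ`; in particular `X_j`, `Y_j`, `∂/∂t` are orthogonal, with
`|X_j|² = |Y_j|² = 4`. -/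
theorem cr_webster (p v w : Heis m) : (cr m).webster p v w =
    4 * ∑ j, ((v.1 j).re * (w.1 j).re + (v.1 j).im * (w.1 j).im) + form p v * form p w := by
  obtain ⟨r, hr⟩ : ∃ r : Heis m, r = (cr m).reeb p := ⟨_, rfl⟩
  have h := levi_form p (v - form p v • r) (w - form p w • r)
  rw [hr] at h
  refine (congrArg (· + form p v * form p w) h).trans ?_
  rw [← hr, hr.trans (cr_reeb p)]
  simp

theorem X_mem (j : Fin m) (p : Heis m) : X j p ∈ (cr m).H p := by
  change form p ((Pi.single j 1, 2 * (p.1 j).im) : Heis m) = 0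
  simp [form_apply, Pi.single_apply, apply_ite]

theorem Y_mem (j : Fin m) (p : Heis m) : Y j p ∈ (cr m).H p := by
  change form p ((Pi.single j Complex.I, -2 * (p.1 j).re) : Heis m) = 0
  simp [form_apply, Pi.single_apply, apply_ite]

theorem J_X (j : Fin m) (p : Heis m) : (cr m).J p ⟨X j p, X_mem j p⟩ = ⟨Y j p, Y_mem j p⟩ := by
  refine Subtype.ext (ext_of_form (p := p) (cplx_mem _ _) (Y_mem j p) ?_)
  change Complex.I • (Pi.single j 1 : Fin m → ℂ) = Pi.single j Complex.I
  ext k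
  simp [Pi.single_apply]

end Heis
end CRGeometry

open CRGeometry

namespace CRGeometry

/-! ### Connections on a vector space, in its global chart. -/

section VectorSpace

variable {F : Type*} [NormedAddCommGroup F] [NormedSpace ℝ F]

/-! The space `Heis m` is a vector space, so its tangent bundle is globally trivial and `β_f(v, w)`
splits as the second derivative `v(W(f)) - (∇_v W)(f)` of the vector-valued function `f`, plus `Γ(df
v, df w)`, where `Γ(a, b)` is the Levi-Civita derivative along `a` of the constant field `b`
(`beta_vectorSpace`). The trace involves only `v = w` horizontal, and then `df v` is horizontal too.

On such vectors `Γ` contributes nothing (`leviCivita_const_self`). On constant fields the Webster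
metric is a constant form plus `θ ⊗ θ`, so each derivative that enters the Koszul computation of
`Γ(a, a)` carries a factor `θ(a)` or `dθ(a, a)`, and both vanish.

Hence the Levi tension is the trace `T` of the second derivative of `f`. Linear coordinates commute
with second derivatives (`hessian_clm_comp`), so the real and imaginary parts of the `ℂᵐ` component
of `T` are the sub-Laplacians of the `φ_j` and `ψ_j`. The `t` component needs no computation: `T` is
horizontal (`form_vectorHessian_self`), because the pull-back of the Heisenberg form is a multiple
of `θ` and `θ` is parallel. A horizontal vector is determined by its `ℂᵐ` component (`eq_sum_X_Y`),
and its norm can be read off from `cr_webster`. -/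

theorem trivializationAt_symm_vectorSpace (p q : F) (v : F) :
    (trivializationAt F (TangentSpace 𝓘(ℝ, F) : F → Type _) p).symm q v = v := by
  have h : q ∈ (trivializationAt F (TangentSpace 𝓘(ℝ, F) : F → Type _) p).baseSet := Set.mem_univ q
  exact (Trivialization.symmL_apply (R := ℝ) _ h v).symm.trans
    (congrArg (fun l : F →L[ℝ] F ↦ l v) (TangentBundle.symmL_model_space (𝕜 := ℝ) (F := F) p q))

theorem trivializationAt_snd_vectorSpace (p q : F) (v : F) :
    (trivializationAt F (TangentSpace 𝓘(ℝ, F) : F → Type _) p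
      ⟨q, (v : TangentSpace 𝓘(ℝ, F) q)⟩).2 = v := by
  simp

/-- The trivialization at any point of a vector space is the identity on every fibre, so the
extension is constant on the whole space, not only near `p`. -/
theorem extend_vectorSpace (p : F) (v : TangentSpace 𝓘(ℝ, F) p) :
    FiberBundle.extend F v = fun q ↦ (v : TangentSpace 𝓘(ℝ, F) q) := by
  funext q
  exact (trivializationAt_symm_vectorSpace p q _).trans (trivializationAt_snd_vectorSpace p p v)

theorem mvfderiv_vectorSpace {G : Type*} [NormedAddCommGroup G] [NormedSpace ℝ G]
    (g : F → G) (p v : F) : mvfderiv 𝓘(ℝ, F) g p v = fderiv ℝ g p v := by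
  simp only [mvfderiv, mfderiv_eq_fderiv]
  rfl

/-- In the global frame the components of a section along `f` are the section itself, read as an
`F`-valued function, and the frame fields are constant. -/
theorem pullbackCov_vectorSpace {E : Type*} [NormedAddCommGroup E] [NormedSpace ℝ E]
    {M : Type*} [TopologicalSpace M] [ChartedSpace E M]
    (D' : CovariantDerivative 𝓘(ℝ, F) F (TangentSpace 𝓘(ℝ, F) : F → Type _))
    (f : M → F) (V : M → F) (x : M) (v : TangentSpace 𝓘(ℝ, E) x) :
    StrictlyPseudoconvexCR.pullbackCov D' f V x v =
      (show TangentSpace 𝓘(ℝ, F) (f x) from mvfderiv 𝓘(ℝ, E) V x v)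
        + D' (fun _ ↦ V x) (f x) (mfderiv 𝓘(ℝ, E) 𝓘(ℝ, F) f x v) := by
  unfold StrictlyPseudoconvexCR.pullbackCov
  have e : (fun y ↦ (trivializationAt F (TangentSpace 𝓘(ℝ, F) : F → Type _) (f x) ⟨f y, V y⟩).2)
      = V := funext fun y ↦ trivializationAt_snd_vectorSpace (f x) (f y) (V y)
  refine congrArg₂ (· + ·) ?_ ?_
  · rw [e]
    exact trivializationAt_symm_vectorSpace _ _ _
  · exact congrArg (fun W : Π q : F, TangentSpace 𝓘(ℝ, F) q ↦
      D' W (f x) (mfderiv 𝓘(ℝ, E) 𝓘(ℝ, F) f x v)) (extend_vectorSpace (f x) (V x))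

/-- Constant fields commute, so vanishing torsion is the symmetry of the Christoffel symbols. -/
theorem IsLeviCivita.const_symm [FiniteDimensional ℝ F]
    {g : Π p : F, TangentSpace 𝓘(ℝ, F) p → TangentSpace 𝓘(ℝ, F) p → ℝ}
    {D : CovariantDerivative 𝓘(ℝ, F) F (TangentSpace 𝓘(ℝ, F) : F → Type _)}
    (hD : IsLeviCivita g D) (p v w : F) :
    D (fun _ ↦ w) p v = D (fun _ ↦ v) p w := by
  have hd : ∀ u : F, MDifferentiableAt 𝓘(ℝ, F) 𝓘(ℝ, F).tangent
      (fun q ↦ TotalSpace.mk' F (E := (TangentSpace 𝓘(ℝ, F) : F → Type _)) q u) p :=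
    fun u ↦ mdiffAt_vectorSpace.2 (differentiableAt_const u)
  have h := D.torsion_apply (hd v) (hd w)
  rw [hD.torsion_free] at h
  have hb : VectorField.mlieBracket 𝓘(ℝ, F) (fun _ : F ↦ v : Π q : F, TangentSpace 𝓘(ℝ, F) q)
      (fun _ : F ↦ w) p = 0 := by
    refine (mlieBracket_vectorSpace (fun _ : F ↦ v) (fun _ ↦ w) p).trans ?_
    rw [fderiv_fun_const, fderiv_fun_const]
    exact sub_self (0 : F)
  rw [hb, sub_zero] at h
  exact sub_eq_zero.1 h.symm

end VectorSpace

/-! ### The Levi-Civita connection of the Heisenberg group on constant fields. -/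

namespace Heis

variable {m : ℕ}

/-- Both summands of `cr_webster` are nonnegative, so both vanish: `v` is horizontal and its `ℂᵐ`
component is zero. -/
theorem eq_zero_of_webster_self {p v : Heis m} (h : (cr m).webster p v v = 0) : v = 0 := by
  have h' := (cr_webster p v v).symm.trans h
  have h1 : 0 ≤ ∑ j, ((v.1 j).re * (v.1 j).re + (v.1 j).im * (v.1 j).im) :=
    Finset.sum_nonneg fun i _ ↦ add_nonneg (mul_self_nonneg _) (mul_self_nonneg _)
  have h2 : form p v = 0 := mul_self_eq_zero.1 (by nlinarith [mul_self_nonneg (form p v)])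
  have h3 : ∑ j, ((v.1 j).re * (v.1 j).re + (v.1 j).im * (v.1 j).im) = 0 := by
    nlinarith [mul_self_nonneg (form p v)]
  refine ext_of_form h2 (map_zero _) (funext fun j ↦ ?_)
  have := (Finset.sum_eq_zero_iff_of_nonneg fun i _ ↦
    add_nonneg (mul_self_nonneg _) (mul_self_nonneg _)).1 h3 j (Finset.mem_univ _)
  exact Complex.normSq_eq_zero.1 ((Complex.normSq_apply _).trans this)

/-- For the Levi-Civita connection of the Webster metric of `ℍᵐ`, the derivative of a constant
field in its own direction vanishes where the field is horizontal. -/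
theorem leviCivita_const_self
    {D : CovariantDerivative 𝓘(ℝ, Heis m) (Heis m) (TangentSpace 𝓘(ℝ, Heis m) : Heis m → Type _)}
    (hD : IsLeviCivita (Heis.cr m).webster D) {p v : Heis m} (hv : form p v = 0) :
    D (fun _ ↦ v) p v = (0 : Heis m) := by
  have hd : ∀ u : Heis m, MDifferentiableAt 𝓘(ℝ, Heis m) 𝓘(ℝ, Heis m).tangent
      (fun q ↦ TotalSpace.mk' (Heis m) (E := (TangentSpace 𝓘(ℝ, Heis m) : Heis m → Type _)) q u) p :=
    fun u ↦ mdiffAt_vectorSpace.2 (differentiableAt_const u)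
  -- On constant fields only the `θ ⊗ θ` part of the metric varies with the point.
  have key : ∀ a b u : Heis m, mvfderiv 𝓘(ℝ, Heis m) (fun q ↦ (cr m).webster q a b) p u =
      fderiv ℝ form p u a * form p b + form p a * fderiv ℝ form p u b := by
    intro a b u
    have hf : ∀ c : Heis m, HasFDerivAt (fun q : Heis m ↦ form q c) ((fderiv ℝ form p).flip c) p :=
      fun c ↦ by
        simpa using! (form_contDiff.differentiable (by simp) p).hasFDerivAt.clm_apply
          (hasFDerivAt_const c p)
    have e : (fun q : Heis m ↦ (cr m).webster q a b) = fun q ↦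
        4 * ∑ j, ((a.1 j).re * (b.1 j).re + (a.1 j).im * (b.1 j).im) + form q a * form q b :=
      funext fun q ↦ cr_webster q a b
    refine (mvfderiv_vectorSpace (fun q ↦ (cr m).webster q a b) p u).trans ?_
    have hab := ((hf a).fun_mul (hf b)).const_add
      (4 * ∑ j, ((a.1 j).re * (b.1 j).re + (a.1 j).im * (b.1 j).im))
    rw [e, hab.fderiv]
    simp
    ring
  -- Koszul argument tested against `z = ∇_v v` itself, extended as a constant field: metricity and
  -- `∇_v z = ∇_z v` give `g(z, z) = v(g(v, z)) - z(g(v, v))/2`. Both derivatives vanish by `key`,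
  -- since `θ(v) = 0` and the derivative of `θ` is skew; definiteness then gives `z = 0`.
  let z : Heis m := D (fun _ ↦ v) p v
  have h1 := hD.metric (fun _ ↦ v) (fun _ ↦ z) p (hd v) (hd z) v
  have h2 := hD.metric (fun _ ↦ v) (fun _ ↦ v) p (hd v) (hd v) z
  have h3 := hD.const_symm p v z
  erw [key, h3] at h1
  erw [key] at h2
  have hs : ∀ a b : Heis m, (cr m).webster p a b = (cr m).webster p b a := by
    intro a b
    refine (cr_webster p a b).trans (Eq.trans ?_ (cr_webster p b a).symm)
    simp only [mul_comm]
  have hvv : fderiv ℝ form p v v = 0 := by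
    rw [fderiv_form, Finset.sum_eq_zero (fun j _ ↦ by ring), mul_zero]
  rw [hv, hvv] at h1
  rw [hv] at h2
  have h4 := hs v (D (fun _ ↦ v) p z)
  refine eq_zero_of_webster_self (p := p) (v := z) ?_
  change (0 : ℝ) * _ + 0 * _ = (cr m).webster p z z + _ at h1
  linarith

end Heis

end CRGeometry

namespace CRGeometry

/-! ### Calculus for vector-valued functions on a manifold. -/

section Differential

variable {E : Type*} [NormedAddCommGroup E] [NormedSpace ℝ E]
  {M : Type*} [TopologicalSpace M] [ChartedSpace E M]
  {F : Type*} [NormedAddCommGroup F] [NormedSpace ℝ F]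
  {G : Type*} [NormedAddCommGroup G] [NormedSpace ℝ G]

theorem mvfderiv_clm_comp (L : F →L[ℝ] G) {f : M → F} {x : M}
    (hf : MDifferentiableAt 𝓘(ℝ, E) 𝓘(ℝ, F) f x) (v : TangentSpace 𝓘(ℝ, E) x) :
    mvfderiv 𝓘(ℝ, E) (fun y ↦ L (f y)) x v = L (mvfderiv 𝓘(ℝ, E) f x v) := by
  have h := (L.hasMFDerivAt (x := f x)).comp x hf.hasMFDerivAt
  exact congrArg (fun l : E →L[ℝ] G ↦ l v) h.mfderiv

/-- The Leibniz rule for the bilinear evaluation pairing, obtained by the chain rule through `y ↦ (A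
y, V y)`. -/
theorem mvfderiv_clm_apply {A : M → F →L[ℝ] G} {V : M → F} {x : M}
    (hA : MDifferentiableAt 𝓘(ℝ, E) 𝓘(ℝ, F →L[ℝ] G) A x)
    (hV : MDifferentiableAt 𝓘(ℝ, E) 𝓘(ℝ, F) V x) (v : TangentSpace 𝓘(ℝ, E) x) :
    mvfderiv 𝓘(ℝ, E) (fun y ↦ A y (V y)) x v =
      mvfderiv 𝓘(ℝ, E) A x v (V x) + A x (mvfderiv 𝓘(ℝ, E) V x v) := by
  have h0 : HasFDerivAt (fun q : (F →L[ℝ] G) × F ↦ q.1 q.2)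
      (((ContinuousLinearMap.apply ℝ G (V x)) ∘L ContinuousLinearMap.fst ℝ (F →L[ℝ] G) F)
        + (A x) ∘L ContinuousLinearMap.snd ℝ (F →L[ℝ] G) F) (A x, V x) := by
    refine ((hasFDerivAt_fst (𝕜 := ℝ) (p := (A x, V x))).clm_apply
      (hasFDerivAt_snd (𝕜 := ℝ) (p := (A x, V x)))).congr_fderiv ?_
    ext <;> simp
  have h := HasMFDerivAt.comp (f := fun y ↦ (A y, V y)) x h0.hasMFDerivAt
    (f' := (mvfderiv 𝓘(ℝ, E) A x).prod (mvfderiv 𝓘(ℝ, E) V x))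
    ⟨hA.hasMFDerivAt.1.prodMk hV.hasMFDerivAt.1, hA.hasMFDerivAt.2.prodMk hV.hasMFDerivAt.2⟩
  refine (congrArg (fun l : E →L[ℝ] G ↦ l v) h.mfderiv).trans ?_
  rfl

variable [IsManifold 𝓘(ℝ, E) ∞ M]

/-- The function is the fibre component of the tangent map of `f` composed with the section `V`, and
the tangent map of a `C²` map is `C¹`. -/
theorem mdifferentiableAt_mvfderiv_apply {f : M → F} (hf : ContMDiff 𝓘(ℝ, E) 𝓘(ℝ, F) 2 f)
    {V : Π y : M, TangentSpace 𝓘(ℝ, E) y} {x : M} (hV : MDiffAt (T% V) x) :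
    MDifferentiableAt 𝓘(ℝ, E) 𝓘(ℝ, F) (fun y ↦ mvfderiv 𝓘(ℝ, E) f y (V y)) x := by
  have h1 := (hf.contMDiff_tangentMap (m := 1) (by norm_num)).mdifferentiable (by simp)
  have h2 := (h1 (T% V x)).comp x hV
  have h3 := ((mdifferentiableAt_totalSpace _ _).1 h2).2
  simpa [tangentMap, Function.comp_def] using! h3

end Differential

/-! ### Second derivatives of maps from a CR manifold. -/

namespace StrictlyPseudoconvexCR

variable {E : Type*} [NormedAddCommGroup E] [NormedSpace ℝ E]
  {M : Type*} [TopologicalSpace M] [ChartedSpace E M] [IsManifold 𝓘(ℝ, E) ∞ M]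
  {F : Type*} [NormedAddCommGroup F] [NormedSpace ℝ F]

/-- The second derivative `v(W(f)) - (∇_v W)(f)` of a vector-valued function `f`, where `W` is the
extension of `w`. -/
noncomputable def vectorHessian
    (D : CovariantDerivative 𝓘(ℝ, E) E (TangentSpace 𝓘(ℝ, E) : M → Type _))
    (f : M → F) (x : M) (v w : TangentSpace 𝓘(ℝ, E) x) : F :=
  mvfderiv 𝓘(ℝ, E) (fun y ↦ mvfderiv 𝓘(ℝ, E) f y (FiberBundle.extend E w y)) x v
    - mvfderiv 𝓘(ℝ, E) f x (D (FiberBundle.extend E w) x v)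

theorem mdiffAt_extend {x : M} (w : TangentSpace 𝓘(ℝ, E) x) :
    MDiffAt (T% (FiberBundle.extend E w : Π y : M, TangentSpace 𝓘(ℝ, E) y)) x :=
  (FiberBundle.contMDiffAt_extend 𝓘(ℝ, E) E w (k := ∞)).mdifferentiableAt (by simp)

/-- Isolates the target connection: it enters only through a term depending on the two vectors `df
v` and `df w` at the point, to which `leviCivita_const_self` applies when they coincide. -/
theorem beta_vectorSpace
    (D : CovariantDerivative 𝓘(ℝ, E) E (TangentSpace 𝓘(ℝ, E) : M → Type _))
    (D' : CovariantDerivative 𝓘(ℝ, F) F (TangentSpace 𝓘(ℝ, F) : F → Type _))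
    (f : M → F) (x : M) (v w : TangentSpace 𝓘(ℝ, E) x) :
    beta D D' f x v w = (show TangentSpace 𝓘(ℝ, F) (f x) from vectorHessian (F := F) D f x v w)
      + D' (fun _ ↦ mvfderiv 𝓘(ℝ, E) f x w) (f x) (mvfderiv 𝓘(ℝ, E) f x v) := by
  have h := pullbackCov_vectorSpace D' f
    (fun y ↦ mvfderiv 𝓘(ℝ, E) f y (FiberBundle.extend E w y)) x v
  rw [FiberBundle.extend_apply_self] at h
  refine (congrArg (· - mfderiv 𝓘(ℝ, E) 𝓘(ℝ, F) f x (D (FiberBundle.extend E w) x v)) h).trans ?_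
  exact add_sub_right_comm _ _ _

/-- A constant linear map passes through both derivatives; `C²` regularity makes the inner
derivative differentiable. Applied with `L` a real coordinate of `ℂᵐ`. -/
theorem hessian_clm_comp
    (D : CovariantDerivative 𝓘(ℝ, E) E (TangentSpace 𝓘(ℝ, E) : M → Type _)) (L : F →L[ℝ] ℝ)
    {f : M → F} (hf : ContMDiff 𝓘(ℝ, E) 𝓘(ℝ, F) 2 f) (x : M) (v w : TangentSpace 𝓘(ℝ, E) x) :
    hessian D (fun y ↦ L (f y)) x v w = L (vectorHessian D f x v w) := by
  have hd : ∀ y, MDifferentiableAt 𝓘(ℝ, E) 𝓘(ℝ, F) f y := hf.mdifferentiable (by simp)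
  unfold hessian vectorHessian
  simp only [mvfderiv_clm_comp L (hd _)]
  rw [mvfderiv_clm_comp L (mdifferentiableAt_mvfderiv_apply hf (mdiffAt_extend w)), map_sub]

variable [FiniteDimensional ℝ E] {n m : ℕ} (S : StrictlyPseudoconvexCR n E M)

/-- The second derivative of a horizontal map in a horizontal direction is horizontal. -/
theorem form_vectorHessian_self
    {D : CovariantDerivative 𝓘(ℝ, E) E (TangentSpace 𝓘(ℝ, E) : M → Type _)}
    (hD : S.IsTanakaWebster D) {f : M → Heis m} (hf : ContMDiff 𝓘(ℝ, E) 𝓘(ℝ, Heis m) 2 f)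
    (hdf : ∀ x, ∀ v ∈ S.H x, Heis.form (f x) (mvfderiv 𝓘(ℝ, E) f x v) = 0)
    (x : M) {v : TangentSpace 𝓘(ℝ, E) x} (hv : v ∈ S.H x) :
    Heis.form (f x) (vectorHessian D f x v v) = 0 := by
  set V : Π y : M, TangentSpace 𝓘(ℝ, E) y := FiberBundle.extend E v with hVdef
  -- Only the value at `x` matters: `U` is a transversal field with `θ(U) = 1` at `x`, and it need
  -- not be the Reeb field elsewhere.
  set U : Π y : M, TangentSpace 𝓘(ℝ, E) y := FiberBundle.extend E (S.reeb x) with hUdef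
  have hVx : V x = v := FiberBundle.extend_apply_self _ _
  have hUx : U x = S.reeb x := FiberBundle.extend_apply_self _ _
  have hV : MDiffAt (T% V) x := mdiffAt_extend v
  have hU : MDiffAt (T% U) x := mdiffAt_extend (S.reeb x)
  have hθ : S.θ x v = 0 := hv
  have hr : S.θ x (S.reeb x) = 1 := (S.reeb_spec x).1
  -- Proportionality of the pulled-back Heisenberg form and `θ`, in cross-multiplied form so that no
  -- conformal factor has to be differentiated. It holds because `θ(b) a - θ(a) b` is horizontal.
  have key : ∀ y, ∀ a b : TangentSpace 𝓘(ℝ, E) y,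
      Heis.form (f y) (mvfderiv 𝓘(ℝ, E) f y a) * S.θ y b =
        S.θ y a * Heis.form (f y) (mvfderiv 𝓘(ℝ, E) f y b) := fun y a b ↦ by
    have h := hdf y (S.θ y b • a - S.θ y a • b) (by simp [H, mul_comm])
    simp only [map_sub, map_smul, smul_eq_mul] at h
    linarith
  have dform : MDifferentiableAt 𝓘(ℝ, E) 𝓘(ℝ, Heis m →L[ℝ] ℝ) (fun y ↦ Heis.form (f y)) x :=
    ((Heis.form_contDiff.differentiable (by simp)) (f x)).mdifferentiableAt.comp x
      (hf.mdifferentiable (by simp) x)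
  have dform_apply : ∀ a, mvfderiv 𝓘(ℝ, E) (fun y ↦ Heis.form (f y)) x a =
      fderiv ℝ Heis.form (f x) (mvfderiv 𝓘(ℝ, E) f x a) := fun a ↦ by
    have h := ((Heis.form_contDiff.differentiable (by simp)) (f x)).hasFDerivAt.hasMFDerivAt.comp x
      (hf.mdifferentiable (by simp) x).hasMFDerivAt
    exact congrArg (fun l : E →L[ℝ] Heis m →L[ℝ] ℝ ↦ l a) h.mfderiv
  have dV := mdifferentiableAt_mvfderiv_apply hf hV
  have dU := mdifferentiableAt_mvfderiv_apply hf hU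
  have dfV : MDifferentiableAt 𝓘(ℝ, E) 𝓘(ℝ, ℝ)
      (fun y ↦ Heis.form (f y) (mvfderiv 𝓘(ℝ, E) f y (V y))) x := dform.clm_apply dV
  have dfU : MDifferentiableAt 𝓘(ℝ, E) 𝓘(ℝ, ℝ)
      (fun y ↦ Heis.form (f y) (mvfderiv 𝓘(ℝ, E) f y (U y))) x := dform.clm_apply dU
  -- Differentiate both sides of `key` for the fields `V`, `U` along `v`. At `x`, `θ(V)` and the
  -- Heisenberg form of `df V` vanish, so one term survives on each side.
  have h1 := mvfderiv_fun_mul dfV (S.θ_smooth.apply_mdiff hU)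
  have h2 := mvfderiv_fun_mul (S.θ_smooth.apply_mdiff hV) dfU
  rw [funext fun y ↦ key y (V y) (U y), h2] at h1
  have h3 := congrArg (fun l ↦ l v) h1
  simp only [add_apply, smul_apply, smul_eq_mul, hVx, hUx,
    hθ, hr, hdf x v hv, hD.parallel_θ V x hV v, mvfderiv_clm_apply dform dV, dform_apply] at h3
  -- `V` is horizontal only at `x`, so `∇_v V` may have a Reeb component. Parallelism of `θ` has
  -- turned `v(θ(V))` into `θ(∇_v V)`; this instance of `key` identifies its product with the
  -- Heisenberg form of `df ξ` as the Heisenberg form of `df(∇_v V)`, exactly the correction term of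
  -- the second derivative.
  have h4 := key x (D V x v) (S.reeb x)
  rw [hr] at h4
  have h5 : ∀ a : Heis m, fderiv ℝ Heis.form (f x) a a = 0 := fun a ↦ by
    rw [Heis.fderiv_form, Finset.sum_eq_zero (fun j _ ↦ by ring), mul_zero]
  rw [h5] at h3
  unfold vectorHessian
  rw [map_sub, ← hVdef]
  linarith

end StrictlyPseudoconvexCR

end CRGeometry

/-! ### Horizontal vectors in the left-invariant frame. -/

namespace CRGeometry.Heis

variable {m : ℕ}

/-- A horizontal vector is the combination of the `X_j` and `Y_j` given by its coordinates. -/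
theorem eq_sum_X_Y {p v : Heis m} (hv : form p v = 0) :
    v = ∑ j, ((v.1 j).re • ((Pi.single j 1, 2 * (p.1 j).im) : Heis m)
      + (v.1 j).im • ((Pi.single j Complex.I, -2 * (p.1 j).re) : Heis m)) := by
  have hX : ∀ j, form p ((Pi.single j 1, 2 * (p.1 j).im) : Heis m) = 0 := fun j ↦ X_mem j p
  have hY : ∀ j, form p ((Pi.single j Complex.I, -2 * (p.1 j).re) : Heis m) = 0 := fun j ↦ Y_mem j p
  refine ext_of_form hv ?_ (funext fun k ↦ ?_)
  · rw [map_sum]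
    exact Finset.sum_eq_zero fun j _ ↦ by
      rw [map_add, map_smul, map_smul, hX, hY, smul_zero, smul_zero, add_zero]
  -- Both sides are horizontal, so only the `ℂᵐ` components remain to be compared, one coordinate
  -- `k` at a time.
  have e : ∀ j, (v.1 j).re • (Pi.single j (1 : ℂ) : Fin m → ℂ) k
      + (v.1 j).im • (Pi.single j Complex.I : Fin m → ℂ) k =
      if k = j then v.1 k else 0 := fun j ↦ by
    rw [Pi.single_apply, Pi.single_apply]
    split_ifs with h
    · subst h
      simp
    · simp
  rw [Prod.fst_sum, Finset.sum_apply]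
  refine Eq.trans ?_ (Finset.sum_congr rfl fun j _ ↦ e j).symm
  simp

end CRGeometry.Heis

/-! ### The Levi tension of a horizontal map into the Heisenberg group. -/

theorem proposition5p1 {n m : ℕ}
    {E : Type*} [NormedAddCommGroup E] [NormedSpace ℝ E] [FiniteDimensional ℝ E]
    {M : Type*} [TopologicalSpace M] [ChartedSpace E M] [IsManifold 𝓘(ℝ, E) ∞ M]
    -- the strictly pseudoconvex CR manifold `(M, θ)` and its Tanaka-Webster connection
    (S : StrictlyPseudoconvexCR n E M)
    (D : CovariantDerivative 𝓘(ℝ, E) E (TangentSpace 𝓘(ℝ, E) : M → Type _))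
    (hD : S.IsTanakaWebster D)
    -- the Levi-Civita connection of the Webster metric of the Heisenberg group
    (D' : CovariantDerivative 𝓘(ℝ, Heis m) (Heis m) (TangentSpace 𝓘(ℝ, Heis m) : Heis m → Type _))
    (hD' : IsLeviCivita (Heis.cr m).webster D')
    (f : M → Heis m) (hf : ContMDiff 𝓘(ℝ, E) 𝓘(ℝ, Heis m) 2 f)
    (hdf : ∀ x, ∀ v ∈ S.H x, mfderiv 𝓘(ℝ, E) 𝓘(ℝ, Heis m) f x v ∈ (Heis.cr m).H (f x)) :
    (∀ x, S.leviTension D D' f x =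
      ∑ j, (S.subLaplacian D (fun y ↦ ((f y).1 j).re) x • Heis.X j (f x)
        + S.subLaplacian D (fun y ↦ ((f y).1 j).im) x • Heis.Y j (f x))) ∧
    (∀ x, S.leviTension D D' f x ∈ (Heis.cr m).H (f x)) ∧
    (∀ x, (Heis.cr m).webster (f x) (S.leviTension D D' f x) (S.leviTension D D' f x) =
      4 * ∑ j, ((S.subLaplacian D (fun y ↦ ((f y).1 j).re) x) ^ 2
        + (S.subLaplacian D (fun y ↦ ((f y).1 j).im) x) ^ 2)) := by
  let reC : Fin m → Heis m →L[ℝ] ℝ := fun j ↦ Complex.reCLM ∘L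
    ContinuousLinearMap.proj (R := ℝ) (φ := fun _ : Fin m ↦ ℂ) j ∘L
      ContinuousLinearMap.fst ℝ (Fin m → ℂ) ℝ
  let imC : Fin m → Heis m →L[ℝ] ℝ := fun j ↦ Complex.imCLM ∘L
    ContinuousLinearMap.proj (R := ℝ) (φ := fun _ : Fin m ↦ ℂ) j ∘L
      ContinuousLinearMap.fst ℝ (Fin m → ℂ) ℝ
  let T : M → Heis m := fun x ↦
    ∑ i, StrictlyPseudoconvexCR.vectorHessian D f x (S.frame x i) (S.frame x i)
  -- The Christoffel term drops out for each frame vector separately, since `df(e_i)` is horizontal.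
  have hT : ∀ x, S.leviTension D D' f x = T x := fun x ↦ by
    unfold StrictlyPseudoconvexCR.leviTension StrictlyPseudoconvexCR.trace
    refine Finset.sum_congr rfl fun i _ ↦ ?_
    refine (StrictlyPseudoconvexCR.beta_vectorSpace D D' f x _ _).trans ?_
    have h := Heis.leviCivita_const_self hD' (hdf x (S.frame x i) (S.frame x i).2)
    exact (congrArg (_ + ·) h).trans (add_zero _)
  have hform : ∀ x, Heis.form (f x) (T x) = 0 := fun x ↦ by
    rw [map_sum]
    exact Finset.sum_eq_zero fun i _ ↦
      S.form_vectorHessian_self hD hf hdf x (S.frame x i).2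
  have hre : ∀ x j, S.subLaplacian D (fun y ↦ ((f y).1 j).re) x = ((T x).1 j).re := fun x j ↦ by
    unfold StrictlyPseudoconvexCR.subLaplacian StrictlyPseudoconvexCR.trace
    exact (Finset.sum_congr rfl fun i _ ↦
      StrictlyPseudoconvexCR.hessian_clm_comp D (reC j) hf x (S.frame x i) (S.frame x i)).trans
        (map_sum (reC j) _ _).symm
  have him : ∀ x j, S.subLaplacian D (fun y ↦ ((f y).1 j).im) x = ((T x).1 j).im := fun x j ↦ by
    unfold StrictlyPseudoconvexCR.subLaplacian StrictlyPseudoconvexCR.trace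
    exact (Finset.sum_congr rfl fun i _ ↦
      StrictlyPseudoconvexCR.hessian_clm_comp D (imC j) hf x (S.frame x i) (S.frame x i)).trans
        (map_sum (imC j) _ _).symm
  refine ⟨fun x ↦ ?_, fun x ↦ ?_, fun x ↦ ?_⟩
  · simp only [hre, him]
    exact (hT x).trans (Heis.eq_sum_X_Y (hform x))
  · rw [hT]
    exact hform x
  -- The `θ ⊗ θ` part of the Webster metric vanishes on `T`, leaving four times the Euclidean square
  -- norm of its `ℂᵐ` component.
  · simp only [hre, him]
    rw [hT]
    refine (Heis.cr_webster (f x) (T x) (T x)).trans ?_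
    rw [hform]
    simp [sq]
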